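/- Let $\mathbb D=\{z\in\mathbb C:|z|<1\}$, $\Pi^+=\{z\in\mathbb C:\operatorname{Re}z>0\}$ and $\Omega=\{x+iy: 0<x<2,\ -1<y<1\}$. For $\alpha>-1$ let $\mathcal A_\alpha$ be the measure on $\mathbb D$ given by $d\mathcal A_\alpha(z)=(\alpha+1)(1-|z|^2)^\alpha\,\frac{dx\,dy}{\pi}$, let $T\colon\mathbb D\to\Pi^+$ be the conformal map $T(z)=\frac{1-z}{1+z}$, and let $\tau_\alpha$ be the image measure on $\Pi^+$, $\tau_\alpha(B)=\mathcal A_\alpha(T^{-1}(B))$ for every Borel set $B\subseteq\Pi^+$. There exist constants $c_1>0$ and $\lambda_1>1$ such that for every $\alpha>-1$ there is a constant $K_\alpha>0$, depending only on $\alpha$, with the following property: every analytic function $f\colon\Pi^+\to\Pi^+$ with $|f(1)|\le c_1$ satisfies, for every $\lambda\ge\lambda_1$, $$\tau_\alpha\big(\{|f|>\lambda\}\cap\Omega\big)\le\frac{K_\alpha}{\lambda^{\alpha+2}}\,\tau_\alpha\big(\{|f|>1\}\cap\Omega\big).$$ -/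

import Mathlib

open MeasureTheory

/-- The open right half-plane `Π⁺ = {z ∈ ℂ : Re z > 0}`. -/
def rightHalfPlane : Set ℂ := {z : ℂ | 0 < z.re}

/-- The open square `Ω = (0, 2) × (-1, 1)`, as a subset of `ℂ`. -/
def squareOmega : Set ℂ := {z : ℂ | 0 < z.re ∧ z.re < 2 ∧ -1 < z.im ∧ z.im < 1}

/-- The weighted measure `d𝒜_α = (α + 1) (1 - |z|²)^α dx dy / π` on the open unit disk,
as a measure on `ℂ` carried by the disk. -/
noncomputable def diskMeasure (α : ℝ) : Measure ℂ :=
  ((volume : Measure ℂ).restrict (Metric.ball (0 : ℂ) 1)).withDensity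
    (fun z => ENNReal.ofReal ((α + 1) * (1 - ‖z‖ ^ 2) ^ α / Real.pi))

/-- The formula `z ↦ (1 - z) / (1 + z)` of the conformal map `T` of the unit disk onto the right
half-plane. -/
noncomputable def cayleyT (z : ℂ) : ℂ := (1 - z) / (1 + z)

theorem measurable_cayleyT : Measurable cayleyT := by
  unfold cayleyT
  fun_prop

/-- The image measure `τ_α = T(𝒜_α)`, as a measure on `ℂ` carried by the right half-plane. -/
noncomputable def tauMeasure (α : ℝ) : Measure ℂ := (diskMeasure α).map cayleyT

/-- `τ_α(B) = 𝒜_α(T⁻¹(B))` for every Borel set `B`. -/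
theorem tauMeasure_apply (α : ℝ) {B : Set ℂ} (hB : MeasurableSet B) :
    tauMeasure α B = diskMeasure α (cayleyT ⁻¹' B) :=
  Measure.map_apply measurable_cayleyT hB

/-!
The idea is that every point of `{|f| > λ}` forces a whole disk on which `|f| > 1`, and that the
part of `{|f| > λ}` near this disk is small by a weak type estimate.

*Weak type estimate.* Let `g` be analytic on the disk with values in the half-plane. The Schwarz
lemma for `(g - g 0) / (g + conj (g 0))` gives `|g z| (1 - |z|) ≤ (1 + |z|) |g 0|`, so that
`{|g| > l}` only meets circles `|z| = r` with `1 - r < 2 |g 0| / l`. On each of these the angular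
measure of `{|g| > l}` is at most `4 π |g 0| / l`, by the mean value property of the nonnegative
harmonic function `Re (g / (g + l))` (`volume_circle_lt_norm_le`). Integration in polar
coordinates yields `𝒜_α {|g| > l} ≤ C (|g 0| / l) ^ (α + 2)` (`diskMeasure_lt_norm_le`).

*Scaling.* On bounded parts of the half-plane `τ_α` is comparable to `x ^ α dx dy`
(`exists_tauMeasure_comparison`), which is homogeneous of degree `α + 2` under `z ↦ v i + s z`.
Hence, within distance `s` of a boundary point `v i`, the set `{|f| > l}` has `τ_α`-measure at most
`K s ^ (α + 2) (|f (s + v i)| / l) ^ (α + 2)` (`exists_tauMeasure_lt_norm_le`).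

*Covering.* If `|f 1| ≤ 1 / 4`, then `|f| ≤ 1` on the part `Re z ≥ 1` of the square, by the Harnack
inequality `norm_le_of_pseudohyperbolic_le`. So for `p` in the square with `|f p| > λ ≥ 2` the
intermediate value theorem provides a point `w` with `Im w = Im p`, `Re p ≤ Re w ≤ 1` and
`|f w| = 2`. Vitali's lemma, for the disks of radius `2 Re w` about `i Im w`, selects points `w`
for which these disks are disjoint while the five times larger disks cover `{|f| > λ}`. Harnack's
inequality bounds `|f|` by `20` at height `10 Re w` above `i Im w`, so the larger disk contributes
at most a multiple of `(Re w / λ) ^ (α + 2)`; it also shows `|f| > 1` on a disk of radius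
`Re w / 8` near `w` (`shiftedBall`), which lies in the square and in the selected disk and
has `τ_α`-measure at least a multiple of `(Re w) ^ (α + 2)`. Summation gives the claim.
-/

/-! ### Analytic maps of the disk into the half-plane -/

theorem norm_sub_lt_norm_add_conj {a b : ℂ} (ha : 0 < a.re) (hb : 0 < b.re) :
    ‖a - b‖ < ‖a + (starRingEnd ℂ) b‖ := by
  rw [← sq_lt_sq₀ (norm_nonneg _) (norm_nonneg _), Complex.sq_norm, Complex.sq_norm,
    Complex.normSq_apply, Complex.normSq_apply]
  simp only [Complex.sub_re, Complex.sub_im, Complex.add_re, Complex.add_im, Complex.conj_re,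
    Complex.conj_im]
  nlinarith [mul_pos ha hb]

/-- Schwarz's lemma for `(g - g 0) / (g + conj (g 0))`, solved for `‖g z‖`. -/
theorem norm_le_of_mapsTo_rightHalfPlane {g : ℂ → ℂ}
    (hg : DifferentiableOn ℂ g (Metric.ball 0 1))
    (hm : Set.MapsTo g (Metric.ball 0 1) rightHalfPlane) {z : ℂ} (hz : ‖z‖ < 1) :
    ‖g z‖ * (1 - ‖z‖) ≤ (1 + ‖z‖) * ‖g 0‖ := by
  have h0 : 0 < (g 0).re := hm (by simp)
  have hne : ∀ w ∈ Metric.ball (0 : ℂ) 1, 0 < ‖g w + (starRingEnd ℂ) (g 0)‖ := fun w hw =>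
    (norm_nonneg _).trans_lt (norm_sub_lt_norm_add_conj (hm hw) h0)
  have key := Complex.norm_le_norm_of_mapsTo_ball
    (f := fun w => (g w - g 0) / (g w + (starRingEnd ℂ) (g 0))) (R := 1) (z := z)
    ((hg.sub_const _).div (hg.add_const _) fun w hw => norm_pos_iff.1 (hne w hw))
    (fun w hw => by
      rw [mem_closedBall_zero_iff, norm_div, div_le_one (hne w hw)]
      exact (norm_sub_lt_norm_add_conj (hm hw) h0).le)
    (by simp) hz
  have hz' : z ∈ Metric.ball (0 : ℂ) 1 := by simpa using hz
  rw [norm_div, div_le_iff₀ (hne z hz')] at key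
  have h1 : ‖g z + (starRingEnd ℂ) (g 0)‖ ≤ ‖g z‖ + ‖g 0‖ :=
    (norm_add_le _ _).trans_eq (by rw [RCLike.norm_conj])
  have h2 := norm_sub_norm_le (g z) (g 0)
  nlinarith [mul_le_mul_of_nonneg_left h1 (norm_nonneg z)]

theorem re_div_add_ofReal_nonneg {a : ℂ} (ha : 0 < a.re) {l : ℝ} (hl : 0 < l) :
    0 ≤ (a / (a + l)).re := by
  rw [Complex.div_re, ← add_div]
  refine div_nonneg ?_ (Complex.normSq_nonneg _)
  simp only [Complex.add_re, Complex.add_im, Complex.ofReal_re, Complex.ofReal_im]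
  nlinarith [mul_pos ha hl, sq_nonneg a.im, sq_nonneg a.re]

theorem half_le_re_div_add_ofReal {a : ℂ} (ha : 0 < a.re) {l : ℝ} (hl : 0 < l) (h : l < ‖a‖) :
    1 / 2 ≤ (a / (a + l)).re := by
  have hsq : l ^ 2 < ‖a‖ ^ 2 := pow_lt_pow_left₀ h hl.le two_ne_zero
  rw [Complex.sq_norm, Complex.normSq_apply] at hsq
  have hpos : 0 < Complex.normSq (a + l) := by
    rw [Complex.normSq_apply]
    simp only [Complex.add_re, Complex.add_im, Complex.ofReal_re, Complex.ofReal_im]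
    nlinarith [mul_pos ha hl, sq_nonneg a.im, sq_nonneg a.re]
  rw [Complex.div_re, ← add_div, div_le_div_iff₀ two_pos hpos, Complex.normSq_apply]
  simp only [Complex.add_re, Complex.add_im, Complex.ofReal_re, Complex.ofReal_im]
  nlinarith [mul_pos ha hl]

/-- Kolmogorov's weak type estimate on a circle: the harmonic function `Re (g / (g + l))` is
nonnegative, is at least `1 / 2` where `l < |g|`, and its mean over the circle is its value at
the centre, which is at most `|g 0| / l`. -/
theorem volume_circle_lt_norm_le {g : ℂ → ℂ}
    (hg : DifferentiableOn ℂ g (Metric.ball 0 1))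
    (hm : Set.MapsTo g (Metric.ball 0 1) rightHalfPlane) {r : ℝ} (hr0 : 0 < r) (hr1 : r < 1)
    {l : ℝ} (hl : 0 < l) :
    volume.restrict (Set.Ioo (-Real.pi) Real.pi) {θ : ℝ | l < ‖g (circleMap 0 r θ)‖} ≤
      ENNReal.ofReal (4 * Real.pi * (‖g 0‖ / l)) := by
  set F : ℂ → ℂ := fun z => g z / (g z + l) with hF
  have h0 : 0 < (g 0).re := hm (by simp)
  have hne : ∀ w ∈ Metric.ball (0 : ℂ) 1, g w + l ≠ 0 := fun w hw h => by
    have h1 : 0 < (g w).re := hm hw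
    have h2 := congrArg Complex.re h
    simp at h2
    linarith
  have hFd : DifferentiableOn ℂ F (Metric.ball 0 1) := hg.div (hg.add_const _) hne
  have hcirc : ∀ θ, circleMap 0 r θ ∈ Metric.ball (0 : ℂ) 1 := fun θ => by
    rw [mem_ball_zero_iff, norm_circleMap_zero, abs_of_pos hr0]; exact hr1
  have hcont : Continuous fun θ => F (circleMap 0 r θ) :=
    hFd.continuousOn.comp_continuous (continuous_circleMap 0 r) hcirc
  have hmean : Real.circleAverage F 0 r = F 0 := by
    refine DiffContOnCl.circleAverage (hFd.diffContOnCl_ball ?_)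
    rw [abs_of_pos hr0]
    exact Metric.closedBall_subset_ball hr1
  have hint : ∫ θ in Set.Ioo (-Real.pi) Real.pi, F (circleMap 0 r θ) = (2 * Real.pi : ℝ) • F 0 := by
    rw [← integral_Ioc_eq_integral_Ioo,
      ← intervalIntegral.integral_of_le (by linarith [Real.pi_pos]), ← hmean,
      Real.circleAverage_def, smul_smul, mul_inv_cancel₀ (by positivity), one_smul]
    have hper : Function.Periodic (fun θ => F (circleMap 0 r θ)) (2 * Real.pi) := fun θ => by
      simp only [periodic_circleMap 0 r θ]
    have := hper.intervalIntegral_add_eq (-Real.pi) 0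
    rwa [zero_add, show -Real.pi + 2 * Real.pi = Real.pi by ring] at this
  have hintb : Integrable (fun θ => F (circleMap 0 r θ))
      (volume.restrict (Set.Ioo (-Real.pi) Real.pi)) :=
    (hcont.integrableOn_Icc (a := -Real.pi) (b := Real.pi)).mono_set Set.Ioo_subset_Icc_self
  have hre : ∫ θ in Set.Ioo (-Real.pi) Real.pi, (F (circleMap 0 r θ)).re =
      2 * Real.pi * (F 0).re := by
    have h := integral_re (𝕜 := ℂ) hintb
    simp only [RCLike.re_eq_complex_re] at h
    rw [h, hint]
    simp
  have hF0 : (F 0).re ≤ ‖g 0‖ / l := by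
    refine (Complex.re_le_norm _).trans ?_
    rw [hF, norm_div]
    refine div_le_div_of_nonneg_left (norm_nonneg _) hl ?_
    calc l ≤ (g 0 + l).re := by simp [h0.le]
      _ ≤ _ := Complex.re_le_norm _
  have hmarkov := mul_meas_ge_le_integral_of_nonneg
    (μ := volume.restrict (Set.Ioo (-Real.pi) Real.pi))
    (f := fun θ => (F (circleMap 0 r θ)).re)
    (Filter.Eventually.of_forall fun θ => re_div_add_ofReal_nonneg (hm (hcirc θ)) hl)
    (hintb.re) (1 / 2)
  rw [hre] at hmarkov
  have hsub : volume.restrict (Set.Ioo (-Real.pi) Real.pi) {θ : ℝ | l < ‖g (circleMap 0 r θ)‖} ≤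
      volume.restrict (Set.Ioo (-Real.pi) Real.pi)
        {θ : ℝ | 1 / 2 ≤ (F (circleMap 0 r θ)).re} :=
    measure_mono fun θ hθ => half_le_re_div_add_ofReal (hm (hcirc θ)) hl hθ
  refine hsub.trans ?_
  rw [← ofReal_measureReal (measure_ne_top _ _)]
  refine ENNReal.ofReal_le_ofReal ?_
  have := mul_le_mul_of_nonneg_left hF0 Real.pi_pos.le
  linarith

theorem lintegral_one_sub_rpow {α : ℝ} (hα : -1 < α) {m : ℝ} (hm : 0 ≤ m) :
    ∫⁻ r in Set.Ioc (1 - m) 1, ENNReal.ofReal ((1 - r) ^ α) =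
      ENNReal.ofReal (m ^ (α + 1) / (α + 1)) := by
  have hi : IntervalIntegrable (fun r : ℝ => (1 - r) ^ α) volume (1 - m) 1 := by
    have := (intervalIntegral.intervalIntegrable_rpow' (a := 0) (b := m) hα).comp_sub_left 1
    simpa using this.symm
  rw [← ofReal_integral_eq_lintegral_ofReal, ← intervalIntegral.integral_of_le (by linarith),
    intervalIntegral.integral_comp_sub_left (fun x : ℝ => x ^ α) 1, integral_rpow (Or.inl hα)]
  · simp [Real.zero_rpow (by linarith : α + 1 ≠ 0)]
  · rwa [intervalIntegrable_iff_integrableOn_Ioc_of_le (by linarith)] at hi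
  · filter_upwards [ae_restrict_mem measurableSet_Ioc] with r hr
    exact Real.rpow_nonneg (by linarith [hr.2]) _

theorem one_sub_sq_rpow_le {α r : ℝ} (h0 : 0 < r) (h1 : r < 1) :
    (1 - r ^ 2) ^ α ≤ max 1 (2 ^ α) * (1 - r) ^ α := by
  rw [show 1 - r ^ 2 = (1 + r) * (1 - r) by ring, Real.mul_rpow (by linarith) (by linarith)]
  refine mul_le_mul_of_nonneg_right ?_ (Real.rpow_nonneg (by linarith) _)
  rcases le_total 0 α with h | h
  · exact (Real.rpow_le_rpow (by linarith) (by linarith) h).trans (le_max_right _ _)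
  · exact (Real.rpow_le_one_of_one_le_of_nonpos (by linarith) h).trans (le_max_left _ _)

/-- The weak type estimate for the weighted area measure. On each circle the set where `l < |g|`
has angular measure at most a multiple of `|g 0| / l`, and it is empty unless the circle
lies within `2 |g 0| / l` of the boundary; integration over the radius gives the exponent
`α + 2`. -/
theorem diskMeasure_lt_norm_le {α : ℝ} (hα : -1 < α) {g : ℂ → ℂ}
    (hg : DifferentiableOn ℂ g (Metric.ball 0 1))
    (hm : Set.MapsTo g (Metric.ball 0 1) rightHalfPlane) {l : ℝ} (hl : 0 < l) :
    diskMeasure α {z : ℂ | z ∈ Metric.ball (0 : ℂ) 1 ∧ l < ‖g z‖} ≤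
      ENNReal.ofReal (2 * max 1 (2 ^ α) * (2 * (‖g 0‖ / l)) ^ (α + 2)) := by
  set E : Set ℂ := {z : ℂ | z ∈ Metric.ball (0 : ℂ) 1 ∧ l < ‖g z‖} with hE
  set m : ℝ := ‖g 0‖ / l with hmdef
  have h0 : 0 < (g 0).re := hm (by simp)
  have hmpos : 0 < m := div_pos (h0.trans_le (Complex.re_le_norm _)) hl
  have hEo : IsOpen E := hg.continuousOn.norm.isOpen_inter_preimage Metric.isOpen_ball isOpen_Ioi
  have hEm := hEo.measurableSet
  have hEsub : E ⊆ Metric.ball 0 1 := fun z hz => hz.1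
  rw [diskMeasure, withDensity_apply _ hEm, Measure.restrict_restrict hEm,
    Set.inter_eq_left.2 hEsub, ← lintegral_indicator hEm, ← Complex.lintegral_comp_polarCoord_symm,
    show polarCoord.target = Set.Ioi (0 : ℝ) ×ˢ Set.Ioo (-Real.pi) Real.pi from rfl,
    Measure.volume_eq_prod, ← Measure.prod_restrict]
  refine (lintegral_prod_le _).trans ?_
  -- `c` collects the constant of the density, the quotient of `(1 - r ^ 2) ^ α` and
  -- `(1 - r) ^ α`, and the bound for the angular measure.
  set c : ℝ := (α + 1) / Real.pi * max 1 (2 ^ α) * (4 * Real.pi * m) with hc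
  have hα1 : 0 < α + 1 := by linarith
  have hc0 : 0 ≤ c := by positivity
  have hinner : ∀ r : ℝ, r ∈ Set.Ioi (0 : ℝ) →
      (∫⁻ θ in Set.Ioo (-Real.pi) Real.pi, ENNReal.ofReal r •
        E.indicator (fun z : ℂ => ENNReal.ofReal ((α + 1) * (1 - ‖z‖ ^ 2) ^ α / Real.pi))
          (Complex.polarCoord.symm (r, θ))) ≤
      (Set.Ioc (1 - 2 * m) 1).indicator (fun r => ENNReal.ofReal (c * (1 - r) ^ α)) r := by
    intro r hr
    have hr0 : 0 < r := hr
    have hsymm : ∀ θ : ℝ, Complex.polarCoord.symm (r, θ) = circleMap 0 r θ := fun θ => by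
      rw [Complex.polarCoord_symm_apply, circleMap, zero_add, Complex.exp_mul_I]
      push_cast
      rfl
    have hnorm : ∀ θ : ℝ, ‖circleMap 0 r θ‖ = r := fun θ => by
      rw [norm_circleMap_zero, abs_of_pos hr0]
    simp only [hsymm, smul_eq_mul]
    by_cases hmem : r < 1 ∧ 1 - 2 * m < r
    · rw [Set.indicator_of_mem (show r ∈ Set.Ioc (1 - 2 * m) 1 from ⟨hmem.2, hmem.1.le⟩)]
      have hset : MeasurableSet {θ : ℝ | circleMap 0 r θ ∈ E} :=
        hEm.preimage (continuous_circleMap 0 r).measurable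
      calc _ = ∫⁻ θ in Set.Ioo (-Real.pi) Real.pi, {θ : ℝ | circleMap 0 r θ ∈ E}.indicator
            (fun _ => ENNReal.ofReal (r * ((α + 1) * (1 - r ^ 2) ^ α / Real.pi))) θ := by
            refine lintegral_congr fun θ => ?_
            by_cases hθ : circleMap 0 r θ ∈ E
            · rw [Set.indicator_of_mem hθ, Set.indicator_of_mem (by exact hθ), hnorm,
                ENNReal.ofReal_mul hr0.le]
            · rw [Set.indicator_of_notMem hθ, Set.indicator_of_notMem (by exact hθ), mul_zero]
        _ = ENNReal.ofReal (r * ((α + 1) * (1 - r ^ 2) ^ α / Real.pi)) *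
            volume.restrict (Set.Ioo (-Real.pi) Real.pi) {θ : ℝ | circleMap 0 r θ ∈ E} :=
            lintegral_indicator_const hset _
        _ ≤ ENNReal.ofReal (r * ((α + 1) * (1 - r ^ 2) ^ α / Real.pi)) *
            ENNReal.ofReal (4 * Real.pi * m) := by
            gcongr
            exact (measure_mono fun θ hθ => hθ.2).trans
              (volume_circle_lt_norm_le hg hm hr0 hmem.1 hl)
        _ ≤ _ := by
            rw [← ENNReal.ofReal_mul' (by positivity)]
            refine ENNReal.ofReal_le_ofReal ?_
            have h1 := one_sub_sq_rpow_le (α := α) hr0 hmem.1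
            have h2 : 0 ≤ (1 - r ^ 2) ^ α := Real.rpow_nonneg (by nlinarith [hmem.1]) _
            calc r * ((α + 1) * (1 - r ^ 2) ^ α / Real.pi) * (4 * Real.pi * m)
                ≤ 1 * ((α + 1) * (max 1 (2 ^ α) * (1 - r) ^ α) / Real.pi) *
                  (4 * Real.pi * m) := by gcongr; exact hmem.1.le
              _ = _ := by rw [hc]; ring
    -- By the Schwarz lemma, the remaining circles do not meet `E`.
    · refine le_of_eq_of_le ?_ zero_le
      rw [lintegral_eq_zero_of_ae_eq_zero]
      refine Filter.Eventually.of_forall fun θ => ?_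
      simp only [Pi.zero_apply]
      rw [Set.indicator_of_notMem, mul_zero]
      rintro ⟨hb, hlt⟩
      have hn := norm_le_of_mapsTo_rightHalfPlane hg hm (mem_ball_zero_iff.1 hb)
      rw [mem_ball_zero_iff, hnorm] at hb
      rw [hnorm] at hn
      refine hmem ⟨hb, ?_⟩
      have h3 : l * (1 - r) < 2 * ‖g 0‖ := by
        have := mul_lt_mul_of_pos_right hlt (sub_pos.2 hb)
        nlinarith [norm_nonneg (g 0)]
      have h4 : 1 - r < 2 * ‖g 0‖ / l := by rw [lt_div_iff₀ hl]; linarith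
      rw [hmdef, ← mul_div_assoc]
      linarith
  refine (setLIntegral_mono' measurableSet_Ioi hinner).trans ?_
  refine (setLIntegral_le_lintegral _ _).trans ?_
  rw [lintegral_indicator measurableSet_Ioc]
  simp only [ENNReal.ofReal_mul hc0]
  rw [lintegral_const_mul _ (by fun_prop), lintegral_one_sub_rpow hα (by positivity),
    ← ENNReal.ofReal_mul hc0]
  refine le_of_eq (congrArg _ ?_)
  rw [show α + 2 = (α + 1) + 1 by ring, Real.rpow_add_one (by positivity) (α + 1), hc]
  generalize (2 * m) ^ (α + 1) = P
  field_simp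
  ring

/-! ### The Cayley transform -/

theorem norm_one_sub_lt_norm_one_add {z : ℂ} (hz : z ∈ rightHalfPlane) : ‖1 - z‖ < ‖1 + z‖ := by
  have h := norm_sub_lt_norm_add_conj (a := z) (b := 1) hz (by simp)
  rwa [map_one, norm_sub_rev, add_comm] at h

theorem one_add_ne_zero_of_mem {z : ℂ} (hz : z ∈ rightHalfPlane) : 1 + z ≠ 0 :=
  norm_pos_iff.1 ((norm_nonneg _).trans_lt (norm_one_sub_lt_norm_one_add hz))

theorem one_add_ne_zero_of_norm_lt_one {z : ℂ} (hz : ‖z‖ < 1) : 1 + z ≠ 0 := fun h => by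
  rw [← neg_eq_iff_add_eq_zero.2 h, norm_neg] at hz
  simp at hz

theorem norm_cayleyT_lt_one {z : ℂ} (hz : z ∈ rightHalfPlane) : ‖cayleyT z‖ < 1 := by
  have h := norm_one_sub_lt_norm_one_add hz
  rw [cayleyT, norm_div, div_lt_one ((norm_nonneg _).trans_lt h)]
  exact h

theorem cayleyT_cayleyT {z : ℂ} (hz : 1 + z ≠ 0) : cayleyT (cayleyT z) = z := by
  unfold cayleyT
  field_simp
  ring

theorem cayleyT_re (z : ℂ) : (cayleyT z).re = (1 - ‖z‖ ^ 2) / ‖1 + z‖ ^ 2 := by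
  rw [cayleyT, Complex.div_re, ← add_div, Complex.sq_norm, Complex.sq_norm, Complex.normSq_apply z]
  simp only [Complex.sub_re, Complex.sub_im, Complex.add_re, Complex.add_im, Complex.one_re,
    Complex.one_im]
  ring

theorem cayleyT_mem_rightHalfPlane {z : ℂ} (hz : ‖z‖ < 1) : cayleyT z ∈ rightHalfPlane := by
  have h := norm_pos_iff.2 (one_add_ne_zero_of_norm_lt_one hz)
  change 0 < (cayleyT z).re
  rw [cayleyT_re]
  have := norm_nonneg z
  exact div_pos (by nlinarith) (by positivity)

theorem one_add_cayleyT {z : ℂ} (hz : 1 + z ≠ 0) : 1 + cayleyT z = 2 / (1 + z) := by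
  unfold cayleyT
  field_simp
  ring

theorem one_sub_norm_cayleyT_sq {z : ℂ} (hz : 1 + z ≠ 0) :
    1 - ‖cayleyT z‖ ^ 2 = 4 * z.re / ‖1 + z‖ ^ 2 := by
  have hpos := norm_pos_iff.2 hz
  have h := cayleyT_re (cayleyT z)
  rw [cayleyT_cayleyT hz, one_add_cayleyT hz, norm_div, Complex.norm_ofNat] at h
  rw [h]
  field_simp
  norm_num

theorem hasDerivAt_cayleyT {z : ℂ} (hz : 1 + z ≠ 0) :
    HasDerivAt cayleyT (-2 / (1 + z) ^ 2) z := by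
  have h1 : HasDerivAt (fun w : ℂ => 1 - w) (-1) z := by
    simpa using (hasDerivAt_id z).const_sub 1
  have h2 : HasDerivAt (fun w : ℂ => 1 + w) 1 z := by
    simpa using (hasDerivAt_id z).const_add 1
  refine (h1.div h2 hz).congr_deriv ?_
  congr 1
  ring

theorem cayleyT_preimage_eq_image {B : Set ℂ} (hB : B ⊆ rightHalfPlane) :
    cayleyT ⁻¹' B = cayleyT '' B := by
  ext z
  constructor
  · intro hz
    -- At the pole the formula has the value `0`, which is not in the half-plane.
    have h1 : 1 + z ≠ 0 := fun h => by
      have h2 : 0 < (cayleyT z).re := hB hz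
      rw [cayleyT, h, div_zero] at h2
      exact lt_irrefl _ h2
    exact ⟨cayleyT z, hz, cayleyT_cayleyT h1⟩
  · rintro ⟨w, hw, rfl⟩
    rwa [Set.mem_preimage, cayleyT_cayleyT (one_add_ne_zero_of_mem (hB hw))]

/-! ### Comparison of `tauMeasure` with a homogeneous measure -/

theorem lintegral_cayleyT_image {B : Set ℂ} (hB : MeasurableSet B) (hsub : B ⊆ rightHalfPlane)
    (g : ℂ → ENNReal) :
    ∫⁻ z in cayleyT '' B, g z =
      ∫⁻ z in B, ENNReal.ofReal (4 / ‖1 + z‖ ^ 4) * g (cayleyT z) := by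
  have hd : ∀ z ∈ B, HasFDerivWithinAt cayleyT
      ((ContinuousLinearMap.toSpanSingleton ℂ (-2 / (1 + z) ^ 2)).restrictScalars ℝ) B z :=
    fun z hz => ((hasDerivAt_cayleyT
      (one_add_ne_zero_of_mem (hsub hz))).hasFDerivAt.restrictScalars ℝ).hasFDerivWithinAt
  have hinj : Set.InjOn cayleyT B := fun a ha b hb hab => by
    rw [← cayleyT_cayleyT (one_add_ne_zero_of_mem (hsub ha)), hab,
      cayleyT_cayleyT (one_add_ne_zero_of_mem (hsub hb))]
  rw [lintegral_image_eq_lintegral_abs_det_fderiv_mul volume hB hd hinj]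
  refine setLIntegral_congr_fun hB fun z hz => ?_
  congr 2
  simp [ContinuousLinearMap.det, LinearMap.det_restrictScalars, Algebra.norm_complex_eq,
    Complex.normSq_eq_norm_sq]
  rw [← pow_mul, abs_of_nonneg (by positivity)]
  norm_num

/-- The measure `x ^ α dx dy` on the right half-plane, as a measure on `ℂ`. -/
noncomputable def halfPlaneMeasure (α : ℝ) : Measure ℂ :=
  ((volume : Measure ℂ).restrict rightHalfPlane).withDensity fun z => ENNReal.ofReal (z.re ^ α)

theorem halfPlaneMeasure_apply (α : ℝ) {B : Set ℂ} (hB : MeasurableSet B)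
    (hsub : B ⊆ rightHalfPlane) :
    halfPlaneMeasure α B = ∫⁻ z in B, ENNReal.ofReal (z.re ^ α) := by
  rw [halfPlaneMeasure, withDensity_apply _ hB, Measure.restrict_restrict hB,
    Set.inter_eq_left.2 hsub]

/-- The density of `tauMeasure α` with respect to `x ^ α dx dy`. -/
theorem tauMeasure_eq_lintegral {α : ℝ} (hα : -1 < α) {B : Set ℂ} (hB : MeasurableSet B)
    (hsub : B ⊆ rightHalfPlane) :
    tauMeasure α B = ∫⁻ z in B, ENNReal.ofReal
      ((α + 1) / Real.pi * (4 / ‖1 + z‖ ^ 4 * (4 / ‖1 + z‖ ^ 2) ^ α)) *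
        ENNReal.ofReal (z.re ^ α) := by
  have hball : cayleyT '' B ⊆ Metric.ball 0 1 := by
    rintro _ ⟨z, hz, rfl⟩
    exact mem_ball_zero_iff.2 (norm_cayleyT_lt_one (hsub hz))
  have hmeas := measurable_cayleyT hB
  rw [tauMeasure_apply α hB, diskMeasure, withDensity_apply _ hmeas,
    Measure.restrict_restrict hmeas, cayleyT_preimage_eq_image hsub,
    Set.inter_eq_left.2 hball, lintegral_cayleyT_image hB hsub]
  refine setLIntegral_congr_fun hB fun z hz => ?_
  have hz0 : 0 < z.re := hsub hz
  have hα1 : 0 < α + 1 := by linarith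
  have hne := one_add_ne_zero_of_mem (hsub hz)
  rw [one_sub_norm_cayleyT_sq hne, ← ENNReal.ofReal_mul (by positivity),
    ← ENNReal.ofReal_mul (by positivity),
    show 4 * z.re / ‖1 + z‖ ^ 2 = 4 / ‖1 + z‖ ^ 2 * z.re by ring,
    Real.mul_rpow (by positivity) hz0.le]
  congr 1
  ring

/-- On bounded parts of the half-plane `tauMeasure α` and `x ^ α dx dy` are comparable, the
quotient of the densities being a continuous function of `‖1 + z‖`. -/
theorem exists_tauMeasure_comparison {α : ℝ} (hα : -1 < α) (R : ℝ) :
    ∃ c C : ℝ, 0 < c ∧ 0 < C ∧ ∀ B : Set ℂ, MeasurableSet B → B ⊆ rightHalfPlane →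
      B ⊆ Metric.closedBall 0 R →
        ENNReal.ofReal c * halfPlaneMeasure α B ≤ tauMeasure α B ∧
        tauMeasure α B ≤ ENNReal.ofReal C * halfPlaneMeasure α B := by
  set D : ℝ → ℝ := fun t => (α + 1) / Real.pi * (4 / t ^ 4 * (4 / t ^ 2) ^ α) with hD
  have hα1 : 0 < α + 1 := by linarith
  have hDpos : ∀ t ∈ Set.Icc 1 (1 + max R 0), 0 < D t := fun t ht => by
    have : 0 < t := one_pos.trans_le ht.1
    positivity
  have hDc : ContinuousOn D (Set.Icc 1 (1 + max R 0)) := by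
    have h0 : ∀ t ∈ Set.Icc 1 (1 + max R 0), t ≠ 0 := fun t ht => (one_pos.trans_le ht.1).ne'
    refine continuousOn_const.mul (ContinuousOn.mul ?_ (ContinuousOn.rpow_const ?_ ?_))
    · exact continuousOn_const.div (by fun_prop) fun t ht => pow_ne_zero _ (h0 t ht)
    · exact continuousOn_const.div (by fun_prop) fun t ht => pow_ne_zero _ (h0 t ht)
    · exact fun t ht => Or.inl (div_ne_zero four_ne_zero (pow_ne_zero _ (h0 t ht)))
  have hne : (Set.Icc 1 (1 + max R 0)).Nonempty :=
    Set.nonempty_Icc.2 (by linarith [le_max_right R 0])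
  obtain ⟨a, ha, hmin⟩ := isCompact_Icc.exists_isMinOn hne hDc
  obtain ⟨b, hb, hmax⟩ := isCompact_Icc.exists_isMaxOn hne hDc
  refine ⟨D a, D b, hDpos a ha, hDpos b hb, fun B hB hsub hR => ?_⟩
  have hmem : ∀ z ∈ B, ‖1 + z‖ ∈ Set.Icc 1 (1 + max R 0) := fun z hz => by
    have hz0 : 0 < z.re := hsub hz
    constructor
    · have := Complex.re_le_norm (1 + z)
      simp only [Complex.add_re, Complex.one_re] at this
      linarith
    · have h1 := mem_closedBall_zero_iff.1 (hR hz)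
      have h2 := norm_add_le 1 z
      rw [norm_one] at h2
      linarith [le_max_left R 0]
  have hm : Measurable fun z : ℂ => ENNReal.ofReal (z.re ^ α) := by fun_prop
  rw [halfPlaneMeasure_apply α hB hsub, tauMeasure_eq_lintegral hα hB hsub,
    ← lintegral_const_mul _ hm, ← lintegral_const_mul _ hm]
  constructor
  · refine setLIntegral_mono' hB fun z hz => ?_
    gcongr
    exact hmin (hmem z hz)
  · refine setLIntegral_mono' hB fun z hz => ?_
    gcongr
    exact hmax (hmem z hz)

/-- The similarity of the half-plane taking `1` to `s + v i`. -/
noncomputable def halfPlaneSimilarity (v s : ℝ) (z : ℂ) : ℂ := v * Complex.I + s * z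

theorem halfPlaneSimilarity_re (v s : ℝ) (z : ℂ) : (halfPlaneSimilarity v s z).re = s * z.re := by
  simp [halfPlaneSimilarity]

theorem halfPlaneSimilarity_im (v s : ℝ) (z : ℂ) :
    (halfPlaneSimilarity v s z).im = v + s * z.im := by
  simp [halfPlaneSimilarity]

theorem halfPlaneSimilarity_mem {v s : ℝ} (hs : 0 < s) {z : ℂ} (hz : z ∈ rightHalfPlane) :
    halfPlaneSimilarity v s z ∈ rightHalfPlane := by
  change 0 < (halfPlaneSimilarity v s z).re
  rw [halfPlaneSimilarity_re]
  exact mul_pos hs hz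

theorem continuous_halfPlaneSimilarity (v s : ℝ) : Continuous (halfPlaneSimilarity v s) := by
  unfold halfPlaneSimilarity
  fun_prop

theorem halfPlaneSimilarity_surjective (v : ℝ) {s : ℝ} (hs : 0 < s) :
    Function.Surjective (halfPlaneSimilarity v s) := fun z => by
  have : (s : ℂ) ≠ 0 := by exact_mod_cast hs.ne'
  refine ⟨(z - v * Complex.I) / s, ?_⟩
  unfold halfPlaneSimilarity
  field_simp
  ring

theorem halfPlaneMeasure_image_similarity (α v : ℝ) {s : ℝ} (hs : 0 < s) {B : Set ℂ}
    (hB : MeasurableSet B) (hsub : B ⊆ rightHalfPlane) :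
    halfPlaneMeasure α (halfPlaneSimilarity v s '' B) =
      ENNReal.ofReal (s ^ (α + 2)) * halfPlaneMeasure α B := by
  have hs' : (s : ℂ) ≠ 0 := by exact_mod_cast hs.ne'
  have hinj : Function.Injective (halfPlaneSimilarity v s) := fun a b hab => by
    simpa [halfPlaneSimilarity, hs'] using hab
  have hd : ∀ z ∈ B, HasFDerivWithinAt (halfPlaneSimilarity v s)
      ((ContinuousLinearMap.toSpanSingleton ℂ (s : ℂ)).restrictScalars ℝ) B z := fun z _ => by
    have h : HasDerivAt (halfPlaneSimilarity v s) (s : ℂ) z :=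
      (((hasDerivAt_id z).const_mul (s : ℂ)).const_add (v * Complex.I)).congr_deriv (mul_one _)
    exact (h.hasFDerivAt.restrictScalars ℝ).hasFDerivWithinAt
  have himg : MeasurableSet (halfPlaneSimilarity v s '' B) :=
    hB.image_of_measurable_injOn (continuous_halfPlaneSimilarity v s).measurable hinj.injOn
  have hsub' : halfPlaneSimilarity v s '' B ⊆ rightHalfPlane := by
    rintro _ ⟨z, hz, rfl⟩
    exact halfPlaneSimilarity_mem hs (hsub hz)
  rw [halfPlaneMeasure_apply α himg hsub', halfPlaneMeasure_apply α hB hsub,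
    lintegral_image_eq_lintegral_abs_det_fderiv_mul volume hB hd hinj.injOn,
    ← lintegral_const_mul _ (by fun_prop)]
  refine setLIntegral_congr_fun hB fun z hz => ?_
  have hz0 : 0 < z.re := hsub hz
  have hdet : |((ContinuousLinearMap.toSpanSingleton ℂ (s : ℂ)).restrictScalars ℝ).det| = s ^ 2 := by
    simp [ContinuousLinearMap.det, LinearMap.det_restrictScalars, Algebra.norm_complex_eq,
      Complex.normSq_eq_norm_sq]
  rw [hdet, halfPlaneSimilarity_re, ← ENNReal.ofReal_mul (by positivity),
    ← ENNReal.ofReal_mul (by positivity), Real.mul_rpow hs.le hz0.le, Real.rpow_add hs,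
    Real.rpow_two]
  congr 1
  ring

theorem halfPlaneMeasure_pos_of_isOpen (α : ℝ) {B : Set ℂ} (hB : IsOpen B) (hne : B.Nonempty)
    (hsub : B ⊆ rightHalfPlane) : 0 < halfPlaneMeasure α B := by
  rw [halfPlaneMeasure_apply α hB.measurableSet hsub, setLIntegral_pos_iff (by fun_prop)]
  refine (hB.measure_pos volume hne).trans_le (measure_mono fun z hz => ⟨?_, hz⟩)
  have hz0 : 0 < z.re := hsub hz
  exact (ENNReal.ofReal_pos.2 (Real.rpow_pos_of_pos hz0 α)).ne'

/-! ### Estimates in the half-plane -/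

theorem differentiableOn_comp_similarity_cayleyT {f : ℂ → ℂ}
    (hf : DifferentiableOn ℂ f rightHalfPlane) (v : ℝ) {s : ℝ} (hs : 0 < s) :
    DifferentiableOn ℂ (fun ζ => f (halfPlaneSimilarity v s (cayleyT ζ))) (Metric.ball 0 1) := by
  have h1 : DifferentiableOn ℂ (fun ζ => halfPlaneSimilarity v s (cayleyT ζ))
      (Metric.ball 0 1) := fun ζ hζ =>
    (((hasDerivAt_cayleyT (one_add_ne_zero_of_norm_lt_one
      (mem_ball_zero_iff.1 hζ))).differentiableAt.const_mul (s : ℂ)).const_add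
        (v * Complex.I)).differentiableWithinAt
  exact hf.comp h1 fun ζ hζ =>
    halfPlaneSimilarity_mem hs (cayleyT_mem_rightHalfPlane (mem_ball_zero_iff.1 hζ))

theorem mapsTo_comp_similarity_cayleyT {f : ℂ → ℂ}
    (hm : Set.MapsTo f rightHalfPlane rightHalfPlane) (v : ℝ) {s : ℝ} (hs : 0 < s) :
    Set.MapsTo (fun ζ => f (halfPlaneSimilarity v s (cayleyT ζ))) (Metric.ball 0 1)
      rightHalfPlane := fun _ hζ =>
  hm (halfPlaneSimilarity_mem hs (cayleyT_mem_rightHalfPlane (mem_ball_zero_iff.1 hζ)))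

theorem cayleyT_zero : cayleyT 0 = 1 := by simp [cayleyT]

/-- A Harnack inequality for the modulus: `ρ` bounds the pseudo-hyperbolic distance of `z`
and `w`. -/
theorem norm_le_of_pseudohyperbolic_le {f : ℂ → ℂ} (hf : DifferentiableOn ℂ f rightHalfPlane)
    (hm : Set.MapsTo f rightHalfPlane rightHalfPlane) {z w : ℂ} (hz : z ∈ rightHalfPlane)
    (hw : w ∈ rightHalfPlane) {ρ : ℝ} (hρ : ‖z - w‖ ≤ ρ * ‖z + (starRingEnd ℂ) w‖) :
    ‖f z‖ * (1 - ρ) ≤ (1 + ρ) * ‖f w‖ := by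
  have hs : 0 < w.re := hw
  have hsC : (w.re : ℂ) ≠ 0 := by exact_mod_cast hs.ne'
  obtain ⟨x, rfl⟩ := halfPlaneSimilarity_surjective w.im hs z
  have hx : x ∈ rightHalfPlane := by
    have h : 0 < (halfPlaneSimilarity w.im w.re x).re := hz
    rw [halfPlaneSimilarity_re] at h
    exact pos_of_mul_pos_right h hs.le
  have hw1 : halfPlaneSimilarity w.im w.re 1 = w := by
    rw [halfPlaneSimilarity, mul_one, add_comm, Complex.re_add_im]
  have hne := one_add_ne_zero_of_mem hx
  have e1 : halfPlaneSimilarity w.im w.re x - w = -(w.re * (1 - x)) := by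
    nth_rewrite 3 [← hw1]
    simp only [halfPlaneSimilarity]
    ring
  have e2 : halfPlaneSimilarity w.im w.re x + (starRingEnd ℂ) w = w.re * (1 + x) := by
    rw [halfPlaneSimilarity]
    apply Complex.ext <;> simp
    ring
  have hζ : ‖cayleyT x‖ ≤ ρ := by
    rw [cayleyT, norm_div, div_le_iff₀ (norm_pos_iff.2 hne)]
    rw [e1, e2, norm_neg, norm_mul, norm_mul, mul_left_comm] at hρ
    exact le_of_mul_le_mul_left hρ (norm_pos_iff.2 hsC)
  have h := norm_le_of_mapsTo_rightHalfPlane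
    (differentiableOn_comp_similarity_cayleyT hf w.im hs)
    (mapsTo_comp_similarity_cayleyT hm w.im hs) (norm_cayleyT_lt_one hx)
  simp only [cayleyT_cayleyT hne, cayleyT_zero, hw1] at h
  nlinarith [mul_le_mul_of_nonneg_left hζ (norm_nonneg (f (halfPlaneSimilarity w.im w.re x))),
    mul_le_mul_of_nonneg_right hζ (norm_nonneg (f w))]

/-- The weak type estimate at scale `s`: the normalisation at `s + v i` reduces it to the disk. -/
theorem exists_tauMeasure_lt_norm_le {α : ℝ} (hα : -1 < α) :
    ∃ K : ℝ, 0 < K ∧ ∀ f : ℂ → ℂ, DifferentiableOn ℂ f rightHalfPlane →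
      Set.MapsTo f rightHalfPlane rightHalfPlane → ∀ v s l : ℝ, |v| ≤ 1 → 0 < s → s ≤ 10 →
      0 < l → ∀ A : Set ℂ, MeasurableSet A → A ⊆ {z | z ∈ rightHalfPlane ∧ l < ‖f z‖} →
      A ⊆ Metric.closedBall (v * Complex.I) s →
        tauMeasure α A ≤ ENNReal.ofReal
          (K * s ^ (α + 2) * (‖f (halfPlaneSimilarity v s 1)‖ / l) ^ (α + 2)) := by
  obtain ⟨c, C, hc, hC, hcmp⟩ := exists_tauMeasure_comparison hα 11
  refine ⟨C / c * (2 * max 1 (2 ^ α) * 2 ^ (α + 2)), by positivity,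
    fun f hf hm v s l hv hs hs10 hl A hA hAf hAb => ?_⟩
  set B : Set ℂ := halfPlaneSimilarity v s ⁻¹' A with hB
  have hBm : MeasurableSet B := (continuous_halfPlaneSimilarity v s).measurable hA
  have himg : halfPlaneSimilarity v s '' B = A :=
    Set.image_preimage_eq A (halfPlaneSimilarity_surjective v hs)
  have hBsub : B ⊆ rightHalfPlane := fun z hz => by
    have h : 0 < (halfPlaneSimilarity v s z).re := (hAf hz).1
    rw [halfPlaneSimilarity_re] at h
    exact pos_of_mul_pos_right h hs.le
  have hBball : B ⊆ Metric.closedBall 0 11 := fun z hz => by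
    have h := hAb hz
    rw [mem_closedBall_iff_norm, halfPlaneSimilarity, add_sub_cancel_left, norm_mul,
      Complex.norm_real, Real.norm_of_nonneg hs.le] at h
    rw [mem_closedBall_zero_iff]
    have : s * ‖z‖ ≤ s * 1 := by linarith
    linarith [le_of_mul_le_mul_left this hs]
  have hAball : A ⊆ Metric.closedBall 0 11 := fun z hz => by
    have h := mem_closedBall_iff_norm.1 (hAb hz)
    rw [mem_closedBall_zero_iff]
    have h2 := norm_add_le (z - v * Complex.I) (v * Complex.I)
    rw [sub_add_cancel, norm_mul, Complex.norm_I, mul_one, Complex.norm_real,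
      Real.norm_eq_abs] at h2
    linarith
  have hτB : tauMeasure α B ≤ ENNReal.ofReal
      (2 * max 1 (2 ^ α) * (2 * (‖f (halfPlaneSimilarity v s 1)‖ / l)) ^ (α + 2)) := by
    have h := diskMeasure_lt_norm_le hα (differentiableOn_comp_similarity_cayleyT hf v hs)
      (mapsTo_comp_similarity_cayleyT hm v hs) hl
    rw [cayleyT_zero] at h
    rw [tauMeasure_apply α hBm, cayleyT_preimage_eq_image hBsub]
    refine (measure_mono ?_).trans h
    rintro _ ⟨z, hz, rfl⟩
    refine ⟨mem_ball_zero_iff.2 (norm_cayleyT_lt_one (hBsub hz)), ?_⟩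
    rw [cayleyT_cayleyT (one_add_ne_zero_of_mem (hBsub hz))]
    exact (hAf hz).2
  have hνB : halfPlaneMeasure α B ≤ ENNReal.ofReal c⁻¹ * tauMeasure α B := by
    have h := mul_le_mul_right (hcmp B hBm hBsub hBball).1 (ENNReal.ofReal c⁻¹)
    rwa [← mul_assoc, ← ENNReal.ofReal_mul (by positivity), inv_mul_cancel₀ hc.ne',
      ENNReal.ofReal_one, one_mul] at h
  calc tauMeasure α A ≤ ENNReal.ofReal C * halfPlaneMeasure α A :=
        (hcmp A hA (fun z hz => (hAf hz).1) hAball).2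
    _ = ENNReal.ofReal C * (ENNReal.ofReal (s ^ (α + 2)) * halfPlaneMeasure α B) := by
        rw [← halfPlaneMeasure_image_similarity α v hs hBm hBsub, himg]
    _ ≤ ENNReal.ofReal C * (ENNReal.ofReal (s ^ (α + 2)) * (ENNReal.ofReal c⁻¹ * ENNReal.ofReal
      (2 * max 1 (2 ^ α) * (2 * (‖f (halfPlaneSimilarity v s 1)‖ / l)) ^ (α + 2)))) := by
        gcongr
        exact hνB.trans (by gcongr)
    _ = _ := by
        rw [← ENNReal.ofReal_mul (by positivity), ← ENNReal.ofReal_mul (by positivity),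
          ← ENNReal.ofReal_mul (by positivity), Real.mul_rpow two_pos.le (by positivity)]
        congr 1
        ring

/-- By homogeneity, the disk of radius `s / 8` about `s + v i` has measure at least a constant times
`s ^ (α + 2)`. -/
theorem exists_le_tauMeasure_ball {α : ℝ} (hα : -1 < α) :
    ∃ c : ℝ, 0 < c ∧ ∀ v s : ℝ, |v| ≤ 1 → 0 < s → s ≤ 1 →
      ENNReal.ofReal (c * s ^ (α + 2)) ≤
        tauMeasure α (Metric.ball (halfPlaneSimilarity v s 1) (s / 8)) := by
  obtain ⟨c, C, hc, -, hcmp⟩ := exists_tauMeasure_comparison hα 3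
  have hball : Metric.ball (1 : ℂ) (1 / 8) ⊆ rightHalfPlane := fun z hz => by
    have h := (Complex.abs_re_le_norm _).trans_lt (mem_ball_iff_norm.1 hz)
    rw [Complex.sub_re, Complex.one_re, abs_lt] at h
    change 0 < z.re
    linarith [h.1]
  obtain ⟨q, hq0, hq⟩ := ENNReal.lt_iff_exists_nnreal_btwn.1
    (halfPlaneMeasure_pos_of_isOpen α Metric.isOpen_ball ⟨1, by simp⟩ hball)
  have hq0' : 0 < q := by exact_mod_cast hq0
  refine ⟨c * q, mul_pos hc hq0', fun v s hv hs hs1 => ?_⟩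
  set S : Set ℂ := halfPlaneSimilarity v s '' Metric.ball (1 : ℂ) (1 / 8) with hS
  have hinj : Function.Injective (halfPlaneSimilarity v s) := fun a b hab => by
    simpa [halfPlaneSimilarity, hs.ne'] using hab
  have hSm : MeasurableSet S :=
    measurableSet_ball.image_of_measurable_injOn
      (continuous_halfPlaneSimilarity v s).measurable hinj.injOn
  have hSr : S ⊆ rightHalfPlane := by
    rintro _ ⟨z, hz, rfl⟩
    exact halfPlaneSimilarity_mem hs (hball hz)
  have hSb : S ⊆ Metric.ball (halfPlaneSimilarity v s 1) (s / 8) := by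
    rintro _ ⟨z, hz, rfl⟩
    rw [mem_ball_iff_norm] at hz ⊢
    rw [halfPlaneSimilarity, halfPlaneSimilarity, add_sub_add_left_eq_sub, ← mul_sub, norm_mul,
      Complex.norm_real, Real.norm_of_nonneg hs.le]
    have := mul_lt_mul_of_pos_left hz hs
    linarith
  have hS3 : S ⊆ Metric.closedBall 0 3 := by
    rintro _ ⟨z, hz, rfl⟩
    rw [mem_ball_iff_norm] at hz
    rw [mem_closedBall_zero_iff, halfPlaneSimilarity]
    have h1 : ‖z‖ ≤ 2 := by
      have := norm_add_le (z - 1) 1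
      rw [sub_add_cancel, norm_one] at this
      linarith
    refine (norm_add_le _ _).trans ?_
    rw [norm_mul, norm_mul, Complex.norm_I, mul_one, Complex.norm_real, Complex.norm_real,
      Real.norm_eq_abs, Real.norm_of_nonneg hs.le]
    nlinarith [norm_nonneg z]
  refine le_trans ?_ (measure_mono hSb)
  refine le_trans ?_ (hcmp S hSm hSr hS3).1
  rw [hS, halfPlaneMeasure_image_similarity α v hs measurableSet_ball hball,
    show c * q * s ^ (α + 2) = c * (s ^ (α + 2) * q) by ring, ENNReal.ofReal_mul hc.le,
    ENNReal.ofReal_mul (by positivity), ENNReal.ofReal_coe_nnreal]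
  gcongr

/-! ### Stopping heights and the covering argument -/

theorem norm_le_one_of_norm_apply_one_le {f : ℂ → ℂ}
    (hf : DifferentiableOn ℂ f rightHalfPlane)
    (hm : Set.MapsTo f rightHalfPlane rightHalfPlane) (h1 : ‖f 1‖ ≤ 1 / 4) {z : ℂ}
    (hz1 : 1 ≤ z.re) (hz2 : z.re ≤ 2) (hi : |z.im| ≤ 1) : ‖f z‖ ≤ 1 := by
  have hz : z ∈ rightHalfPlane := one_pos.trans_le hz1
  have hi2 : z.im ^ 2 ≤ 1 := (sq_le_one_iff_abs_le_one _).2 hi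
  have h := norm_le_of_pseudohyperbolic_le hf hm hz (w := 1) (ρ := 3 / 5)
    (by change (0 : ℝ) < Complex.re 1; simp) (by
      rw [← sq_le_sq₀ (norm_nonneg _) (by positivity), mul_pow, Complex.sq_norm, Complex.sq_norm,
        Complex.normSq_apply, Complex.normSq_apply]
      simp
      nlinarith)
  linarith

/-- On the horizontal ray through a point where `2 < |f|`, the modulus drops to `2` at some
height `s ≤ 1`. -/
theorem exists_stopping_height {f : ℂ → ℂ} (hf : DifferentiableOn ℂ f rightHalfPlane)
    (hm : Set.MapsTo f rightHalfPlane rightHalfPlane) (h1 : ‖f 1‖ ≤ 1 / 4) {p : ℂ}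
    (hp : p ∈ squareOmega) (hfp : 2 < ‖f p‖) :
    ∃ s : ℝ, p.re ≤ s ∧ s ≤ 1 ∧ ‖f ⟨s, p.im⟩‖ = 2 := by
  obtain ⟨hp0, hp2, hi1, hi2⟩ := hp
  have hi : |p.im| ≤ 1 := abs_le.2 ⟨hi1.le, hi2.le⟩
  have hp1 : p.re ≤ 1 := by
    by_contra! h
    linarith [norm_le_one_of_norm_apply_one_le hf hm h1 h.le hp2.le hi]
  have hend : ‖f ⟨1, p.im⟩‖ ≤ 1 :=
    norm_le_one_of_norm_apply_one_le hf hm h1 (z := ⟨1, p.im⟩) le_rfl one_le_two hi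
  have hline : Continuous fun t : ℝ => (⟨t, p.im⟩ : ℂ) := by
    have : (fun t : ℝ => (⟨t, p.im⟩ : ℂ)) = fun t : ℝ => (t : ℂ) + p.im * Complex.I := by
      funext t
      exact Complex.mk_eq_add_mul_I t p.im
    rw [this]
    fun_prop
  have hcont : ContinuousOn (fun t : ℝ => ‖f ⟨t, p.im⟩‖) (Set.Icc p.re 1) :=
    (hf.continuousOn.comp hline.continuousOn fun t ht => hp0.trans_le ht.1).norm
  obtain ⟨s, hs, hs2⟩ := intermediate_value_Icc' hp1 hcont
    (show (2 : ℝ) ∈ Set.Icc _ _ from ⟨by linarith, hfp.le⟩)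
  exact ⟨s, hs.1, hs.2, hs2⟩

/-- The disk of radius `s / 8` about `s + (1 - s / 8) v i`. It is moved from the point
`w = s + v i` towards the real axis so that it stays inside `squareOmega`. -/
def shiftedBall (w : ℂ) : Set ℂ :=
  Metric.ball (halfPlaneSimilarity ((1 - w.re / 8) * w.im) w.re 1) (w.re / 8)

theorem norm_sub_lt_of_mem_shiftedBall {w z : ℂ} (h0 : 0 < w.re) (hi : |w.im| ≤ 1)
    (hz : z ∈ shiftedBall w) : ‖z - w‖ < w.re / 4 := by
  have h := mem_ball_iff_norm.1 hz
  have e : halfPlaneSimilarity ((1 - w.re / 8) * w.im) w.re 1 - w =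
      ((-(w.re / 8 * w.im) : ℝ) : ℂ) * Complex.I := by
    apply Complex.ext <;> simp [halfPlaneSimilarity]
    ring
  have h2 : ‖halfPlaneSimilarity ((1 - w.re / 8) * w.im) w.re 1 - w‖ ≤ w.re / 8 := by
    rw [e, norm_mul, Complex.norm_I, mul_one, Complex.norm_real, Real.norm_eq_abs, abs_neg,
      abs_mul, abs_of_pos (by positivity)]
    exact mul_le_of_le_one_right (by positivity) hi
  have h3 := norm_add_le (z - halfPlaneSimilarity ((1 - w.re / 8) * w.im) w.re 1)
    (halfPlaneSimilarity ((1 - w.re / 8) * w.im) w.re 1 - w)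
  rw [sub_add_sub_cancel] at h3
  linarith

theorem shiftedBall_subset_squareOmega {w : ℂ} (h0 : 0 < w.re) (h1 : w.re ≤ 1)
    (hi : |w.im| ≤ 1) : shiftedBall w ⊆ squareOmega := fun z hz => by
  have h := norm_sub_lt_of_mem_shiftedBall h0 hi hz
  have hre := (Complex.abs_re_le_norm _).trans_lt h
  rw [Complex.sub_re, abs_lt] at hre
  have him := (Complex.abs_im_le_norm _).trans_lt (mem_ball_iff_norm.1 hz)
  rw [Complex.sub_im, halfPlaneSimilarity_im, Complex.one_im, mul_zero, add_zero, abs_lt] at him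
  obtain ⟨hi1, hi2⟩ := abs_le.1 hi
  have hs : 0 ≤ 1 - w.re / 8 := by linarith
  have a1 := mul_le_mul_of_nonneg_left hi1 hs
  have a2 := mul_le_mul_of_nonneg_left hi2 hs
  exact ⟨by linarith [hre.1], by linarith [hre.2], by linarith [him.1], by linarith [him.2]⟩

theorem shiftedBall_subset_closedBall {w : ℂ} (h0 : 0 < w.re) (hi : |w.im| ≤ 1) :
    shiftedBall w ⊆ Metric.closedBall (w.im * Complex.I) (2 * w.re) := fun z hz => by
  have h := norm_sub_lt_of_mem_shiftedBall h0 hi hz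
  have e : w - w.im * Complex.I = (w.re : ℂ) := by
    nth_rewrite 1 [← Complex.re_add_im w]
    ring
  have h2 := norm_add_le (z - w) (w - w.im * Complex.I)
  rw [sub_add_sub_cancel, e, Complex.norm_real, Real.norm_of_nonneg h0.le] at h2
  rw [mem_closedBall_iff_norm]
  linarith

theorem one_lt_norm_of_mem_shiftedBall {f : ℂ → ℂ} (hf : DifferentiableOn ℂ f rightHalfPlane)
    (hm : Set.MapsTo f rightHalfPlane rightHalfPlane) {w z : ℂ} (h0 : 0 < w.re)
    (hi : |w.im| ≤ 1) (hw : ‖f w‖ = 2) (hz : z ∈ shiftedBall w) : 1 < ‖f z‖ := by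
  have h := norm_sub_lt_of_mem_shiftedBall h0 hi hz
  have hre := (Complex.abs_re_le_norm _).trans_lt h
  rw [Complex.sub_re, abs_lt] at hre
  have hz0 : 0 < z.re := by linarith [hre.1]
  have h2 := Complex.re_le_norm (w + (starRingEnd ℂ) z)
  rw [Complex.add_re, Complex.conj_re] at h2
  have h3 := norm_le_of_pseudohyperbolic_le hf hm (z := w) (w := z) (ρ := 1 / 4) h0 hz0 (by
    rw [norm_sub_rev]
    linarith)
  linarith

theorem norm_le_at_tenfold_height {f : ℂ → ℂ} (hf : DifferentiableOn ℂ f rightHalfPlane)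
    (hm : Set.MapsTo f rightHalfPlane rightHalfPlane) {w : ℂ} (h0 : 0 < w.re)
    (hw : ‖f w‖ = 2) : ‖f (halfPlaneSimilarity w.im (10 * w.re) 1)‖ ≤ 20 := by
  have hmem : halfPlaneSimilarity w.im (10 * w.re) 1 ∈ rightHalfPlane :=
    halfPlaneSimilarity_mem (by positivity) (by change (0 : ℝ) < Complex.re 1; simp)
  have e1 : halfPlaneSimilarity w.im (10 * w.re) 1 - w = ((9 * w.re : ℝ) : ℂ) := by
    apply Complex.ext <;> simp [halfPlaneSimilarity]
    ring
  have e2 : halfPlaneSimilarity w.im (10 * w.re) 1 + (starRingEnd ℂ) w =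
      ((11 * w.re : ℝ) : ℂ) := by
    apply Complex.ext <;> simp [halfPlaneSimilarity]
    ring
  have h := norm_le_of_pseudohyperbolic_le hf hm hmem (w := w) (ρ := 9 / 11) h0 (by
    rw [e1, e2, Complex.norm_real, Complex.norm_real, Real.norm_of_nonneg (by positivity),
      Real.norm_of_nonneg (by positivity)]
    linarith)
  linarith

theorem mainTheorem4 :
    ∃ c₁ : ℝ, 0 < c₁ ∧ ∃ l₁ : ℝ, 1 < l₁ ∧
      ∀ α : ℝ, -1 < α → ∃ K : ℝ, 0 < K ∧
        ∀ f : ℂ → ℂ, AnalyticOnNhd ℂ f rightHalfPlane →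
          Set.MapsTo f rightHalfPlane rightHalfPlane → ‖f 1‖ ≤ c₁ →
          ∀ l : ℝ, l₁ ≤ l →
            tauMeasure α ({z : ℂ | l < ‖f z‖} ∩ squareOmega) ≤
              ENNReal.ofReal (K / l ^ (α + 2)) *
                tauMeasure α ({z : ℂ | 1 < ‖f z‖} ∩ squareOmega) := by
  refine ⟨1 / 4, by norm_num, 2, one_lt_two, fun α hα => ?_⟩
  obtain ⟨K, hK, hupper⟩ := exists_tauMeasure_lt_norm_le hα
  obtain ⟨c, hc, hlower⟩ := exists_le_tauMeasure_ball hα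
  refine ⟨K * 200 ^ (α + 2) / c, by positivity, fun f hfa hm h1 l hl => ?_⟩
  have hf : DifferentiableOn ℂ f rightHalfPlane := hfa.differentiableOn
  have hl0 : 0 < l := by linarith
  set A : Set ℂ := {z : ℂ | l < ‖f z‖} ∩ squareOmega with hAdef
  have hΩ : IsOpen squareOmega := by
    unfold squareOmega
    exact (isOpen_lt continuous_const Complex.continuous_re).inter
      ((isOpen_lt Complex.continuous_re continuous_const).inter
        ((isOpen_lt continuous_const Complex.continuous_im).inter
          (isOpen_lt Complex.continuous_im continuous_const)))
  have hΩsub : squareOmega ⊆ rightHalfPlane := fun z hz => hz.1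
  have hA : MeasurableSet A := by
    rw [hAdef, Set.inter_comm]
    exact ((hf.continuousOn.mono hΩsub).norm.isOpen_inter_preimage hΩ
      isOpen_Ioi).measurableSet
  -- The stopping points: every point of `A` lies straight between the imaginary axis and one of
  -- them.
  set t : Set ℂ := {w | 0 < w.re ∧ w.re ≤ 1 ∧ |w.im| ≤ 1 ∧ ‖f w‖ = 2} with ht
  obtain ⟨u, hut, hdisj, hcover⟩ :=
    Vitali.exists_disjoint_subfamily_covering_enlargement_closedBall t
      (fun w : ℂ => (w.im : ℂ) * Complex.I) (fun w => 2 * w.re) 2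
      (fun w hw => by linarith [hw.2.1]) 5 (by norm_num)
  have hdisj' : u.PairwiseDisjoint shiftedBall := fun a ha b hb hab =>
    (hdisj ha hb hab).mono (shiftedBall_subset_closedBall (hut ha).1 (hut ha).2.2.1)
      (shiftedBall_subset_closedBall (hut hb).1 (hut hb).2.2.1)
  have hcount : u.Countable := hdisj'.countable_of_isOpen (fun _ _ => Metric.isOpen_ball)
    fun w hw => Metric.nonempty_ball.2 (by linarith [(hut hw).1])
  have hAcover : A ⊆ ⋃ w ∈ u, A ∩ Metric.closedBall (w.im * Complex.I) (10 * w.re) := by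
    intro p hp
    -- The disk of radius `2 s` about `i Im p` contains `p`, since `Re p ≤ s`.
    obtain ⟨s, hps, hs1, hs2⟩ := exists_stopping_height hf hm h1 hp.2 (hl.trans_lt hp.1)
    have hp0 : 0 < p.re := hp.2.1
    obtain ⟨w, hw, hsub⟩ := hcover ⟨s, p.im⟩
      ⟨hp0.trans_le hps, hs1, abs_le.2 ⟨hp.2.2.2.1.le, hp.2.2.2.2.le⟩, hs2⟩
    refine Set.mem_biUnion hw ⟨hp, ?_⟩
    have h10 : 5 * (2 * w.re) = 10 * w.re := by ring
    rw [h10] at hsub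
    refine hsub ?_
    have e : p - p.im * Complex.I = (p.re : ℂ) := by
      nth_rewrite 1 [← Complex.re_add_im p]
      ring
    rw [mem_closedBall_iff_norm]
    simp only
    rw [e, Complex.norm_real, Real.norm_of_nonneg hp0.le]
    linarith
  -- The constant is `200 = 10 * 20`: the enlarged disk has radius `10 Re w`, and `‖f‖ ≤ 20` at the
  -- point of that height.
  have htile : ∀ w ∈ u, tauMeasure α (A ∩ Metric.closedBall (w.im * Complex.I) (10 * w.re)) ≤
      ENNReal.ofReal (K * 200 ^ (α + 2) / c / l ^ (α + 2)) * tauMeasure α (shiftedBall w) := by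
    intro w hw
    obtain ⟨hw0, hw1, hwi, hw2⟩ := hut hw
    have hv : |(1 - w.re / 8) * w.im| ≤ 1 := by
      rw [abs_mul, abs_of_nonneg (by linarith)]
      exact mul_le_one₀ (by linarith) (abs_nonneg _) hwi
    calc _ ≤ ENNReal.ofReal (K * (10 * w.re) ^ (α + 2) *
          (‖f (halfPlaneSimilarity w.im (10 * w.re) 1)‖ / l) ^ (α + 2)) :=
          hupper f hf hm w.im (10 * w.re) l hwi (by positivity) (by linarith) hl0 _
            (hA.inter measurableSet_closedBall) (fun z hz => ⟨hΩsub hz.1.2, hz.1.1⟩)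
            Set.inter_subset_right
      _ ≤ ENNReal.ofReal (K * (10 * w.re) ^ (α + 2) * (20 / l) ^ (α + 2)) := by
          have h20 := norm_le_at_tenfold_height hf hm hw0 hw2
          have : 0 ≤ α + 2 := by linarith
          gcongr
      _ = ENNReal.ofReal (K * 200 ^ (α + 2) / c / l ^ (α + 2)) *
          ENNReal.ofReal (c * w.re ^ (α + 2)) := by
          rw [← ENNReal.ofReal_mul (by positivity), Real.mul_rpow (by norm_num) hw0.le,
            Real.div_rpow (by norm_num) hl0.le, show (200 : ℝ) = 10 * 20 by norm_num,
            Real.mul_rpow (x := 10) (y := 20) (by norm_num) (by norm_num)]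
          congr 1
          field_simp
      _ ≤ _ := by
          gcongr
          exact hlower _ _ hv hw0 hw1
  calc tauMeasure α A
      ≤ tauMeasure α (⋃ w ∈ u, A ∩ Metric.closedBall (w.im * Complex.I) (10 * w.re)) :=
        measure_mono hAcover
    _ ≤ ∑' w : u, tauMeasure α
          (A ∩ Metric.closedBall ((w : ℂ).im * Complex.I) (10 * (w : ℂ).re)) :=
        measure_biUnion_le _ hcount _
    _ ≤ ∑' w : u, ENNReal.ofReal (K * 200 ^ (α + 2) / c / l ^ (α + 2)) *
          tauMeasure α (shiftedBall w) := ENNReal.tsum_le_tsum fun w => htile w w.2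
    _ = ENNReal.ofReal (K * 200 ^ (α + 2) / c / l ^ (α + 2)) *
          tauMeasure α (⋃ w ∈ u, shiftedBall w) := by
        rw [ENNReal.tsum_mul_left, measure_biUnion hcount hdisj' fun _ _ => measurableSet_ball]
    _ ≤ _ := by
        gcongr
        refine Set.iUnion₂_subset fun w hw z hz => ?_
        obtain ⟨hw0, hw1, hwi, hw2⟩ := hut hw
        exact ⟨one_lt_norm_of_mem_shiftedBall hf hm hw0 hwi hw2 hz,
          shiftedBall_subset_squareOmega hw0 hw1 hwi hz⟩
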